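/- **Matrix completion, kernel regime.** Let $d, n \ge 1$, let $X^* \in \mathbb{R}^{d\times d}$ be a symmetric matrix, let $x_1,\dots,x_n \in [d]\times[d]$ be sampled positions (repetitions allowed), and let $\Omega=\{x_1,\dots,x_n\}$ be the set of observed entries. For $\theta=(U,V)$ with $U,V\in\mathbb{R}^{d\times d}$ put $W(\theta)=UU^\top-VV^\top$, and for $\lambda>0$ let $$\mathcal{L}_\lambda(\theta)=\frac1n\sum_{k=1}^n\bigl([W(\theta)]_{x_k}-X^*_{x_k}\bigr)^2+\frac{\lambda}{2}\bigl(\|U\|_F^2+\|V\|_F^2\bigr).$$ Let the weight decay $\lambda=\lambda(\alpha)>0$ be a function of $\alpha>0$ with $\lambda(\alpha)=\Theta(\alpha^{-p})$ as $\alpha\to+\infty$, for some constant $p>0$. For every $\alpha>0$, the gradient flow $\frac{\mathrm{d}\theta}{\mathrm{d}t}=-\nabla\mathcal{L}_{\lambda(\alpha)}(\theta)$ started from $\alpha\bar\theta_{\mathrm{init}}$, where $\bar\theta_{\mathrm{init}}=(I,I)$, exists for all $t\ge 0$; write $\theta(t;\alpha\bar\theta_{\mathrm{init}})$ for it. Then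 for every constant $c\in(0,1)$, with $T_c^-(\alpha)=\frac{1-c}{\lambda(\alpha)}\log\alpha$, it holds for all $(i,j)\in[d]\times[d]$ that $$\lim_{\alpha\to+\infty}\bigl[W(\theta(T_c^-(\alpha);\alpha\bar\theta_{\mathrm{init}}))\bigr]_{ij}=\begin{cases}X^*_{ij}&\text{if }(i,j)\in\Omega\text{ or }(j,i)\in\Omega,\\0&\text{otherwise.}\end{cases}$$ -/

import Mathlib

open Filter Topology Asymptotics

noncomputable section

namespace MatrixCompletion

/-- The parameter space `ℝ^{2d²}` of vectors `θ = (vec U, vec V)` with `U, V ∈ ℝ^{d×d}`, with the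
Euclidean norm, so that `‖θ‖² = ‖U‖_F² + ‖V‖_F²`. -/
abbrev Param (d : ℕ) : Type :=
  EuclideanSpace ℝ ((Fin d × Fin d) ⊕ (Fin d × Fin d))

/-- The vector `(vec U, vec V)`. -/
def pack {d : ℕ} (U V : Matrix (Fin d) (Fin d) ℝ) : Param d :=
  WithLp.toLp 2 (Sum.elim (fun q => U q.1 q.2) (fun q => V q.1 q.2))

/-- The block `U` of `θ = (vec U, vec V)`. -/
def matU {d : ℕ} (θ : Param d) : Matrix (Fin d) (Fin d) ℝ :=
  Matrix.of fun i j => θ (Sum.inl (i, j))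

/-- The block `V` of `θ = (vec U, vec V)`. -/
def matV {d : ℕ} (θ : Param d) : Matrix (Fin d) (Fin d) ℝ :=
  Matrix.of fun i j => θ (Sum.inr (i, j))

/-- The learned matrix `W(θ) = U Uᵀ - V Vᵀ`. -/
def matW {d : ℕ} (θ : Param d) : Matrix (Fin d) (Fin d) ℝ :=
  matU θ * (matU θ).transpose - matV θ * (matV θ).transpose

/-- The model output `f(θ; (i, j)) = ⟨e_i e_jᵀ, W(θ)⟩`, which is the `(i, j)` entry of `W(θ)`. -/
def modelOutput {d : ℕ} (θ : Param d) (q : Fin d × Fin d) : ℝ :=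
  matW θ q.1 q.2

/-- The training loss with weight decay `lam`: the mean over the samples of the squared error on
the sampled entries of `Xstar`, plus `(lam / 2) (‖U‖_F² + ‖V‖_F²)`. -/
def regLoss {d n : ℕ} (Xstar : Matrix (Fin d) (Fin d) ℝ) (x : Fin n → Fin d × Fin d) (lam : ℝ)
    (θ : Param d) : ℝ :=
  (1 / (n : ℝ)) * ∑ k, (modelOutput θ (x k) - Xstar (x k).1 (x k).2) ^ 2 + lam / 2 * ‖θ‖ ^ 2

/-- `θ : [0, ∞) → ℝ^{2d²}` is the trajectory of gradient flow on the regularized loss started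
from `θ₀`: `θ(0) = θ₀` and `dθ/dt = -∇L_lam(θ(t))` for all `t ≥ 0` (one-sided at `t = 0`). -/
def IsGradientFlow {d n : ℕ} (Xstar : Matrix (Fin d) (Fin d) ℝ) (x : Fin n → Fin d × Fin d)
    (lam : ℝ) (θ₀ : Param d) (θ : ℝ → Param d) : Prop :=
  θ 0 = θ₀ ∧
    ∀ t : ℝ, 0 ≤ t →
      HasDerivWithinAt θ (-gradient (regLoss Xstar x lam) (θ t)) (Set.Ici 0) t

/-- The initialization direction `(I, I)`. -/
def initDir (d : ℕ) : Param d := pack 1 1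

/-- The set `Ω` of observed entries. -/
def observed {d n : ℕ} (x : Fin n → Fin d × Fin d) : Finset (Fin d × Fin d) :=
  Finset.univ.image x

end MatrixCompletion

end

/-! The symmetrized residual `S = a ⊙ (W - X)` turns the flow into `U' = -S U - λ U`, `V' = S V - λ
V`. Dividing by the common scale `α e^{-λt}` removes the decay and leaves `A' = -S A`, `B' = S B`,
which conserves `AᵀB = 1`. With `μ = α² e^{-2λt}` and `Z = AAᵀ - BBᵀ` one has `W = μ Z`.

The conservation law gives `AAᵀ + BBᵀ = 2 + E` with `E = (A - B)(A - B)ᵀ` positive semidefinite and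
`‖E‖ ≤ ‖Z‖² / 4` (`norm_gap_le`). Hence `Z' = -(S(2 + E) + (2 + E)S)`, a linear kernel dynamics up
to a quadratic error.

Observed entries: `E ≥ 0` only helps, so the weighted error decays at rate at least of order `m =
μ(T)`, up to a bias `(λ/m)²` (`weightedError_le`). At time `T = (1 - c) log α / λ` the scale is `m =
α^{2c}`, so both terms vanish.

Unobserved entries: integrating this decay bounds `∫‖S‖` by `G = O(log α / m)`, so `‖Z‖ = O(G)` and
`‖E‖ = O(G²)`. There `S` vanishes, only the terms in `E` drive `Z`, and `Z = O(G³)`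
(`abs_gramDiff_apply_le`). Thus `W = O(m G³)`, which tends to zero. -/

/-! ### Global existence of gradient flow. -/

section GlobalExistence

open Set NNReal

/-- A bounded Lipschitz vector field has a forward integral curve on `[0, ∞)`. -/
theorem exists_forward_integralCurve_of_lipschitzWith_of_bounded {E : Type*}
    [NormedAddCommGroup E] [NormedSpace ℝ E] [CompleteSpace E] {f : E → E} {K L : ℝ≥0}
    (hf : LipschitzWith K f) (hL : ∀ x, ‖f x‖ ≤ L) (x₀ : E) :
    ∃ γ : ℝ → E, γ 0 = x₀ ∧ ∀ t : ℝ, 0 ≤ t → HasDerivWithinAt γ (f (γ t)) (Ici 0) t := by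
  have hloc : ∀ N : ℕ, ∃ γ : ℝ → E, γ 0 = x₀ ∧
      ∀ t ∈ Icc (0 : ℝ) N, HasDerivWithinAt γ (f (γ t)) (Icc 0 N) t := by
    intro N
    -- In time `N` a field bounded by `L` moves a point by at most `L * N`, so this radius allows an
    -- arbitrarily long interval.
    have hP : IsPicardLindelof (fun _ : ℝ => f) (tmin := 0) (tmax := N)
        ⟨0, by simp⟩ x₀ (L * N) 0 L K := by
      refine IsPicardLindelof.of_time_independent (fun x _ => hL x) hf.lipschitzOnWith ?_
      simp
    exact hP.exists_eq_forall_mem_Icc_hasDerivWithinAt₀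
  choose γ hγ0 hγ using hloc
  have hright : ∀ N : ℕ, ∀ t ∈ Ico (0 : ℝ) N,
      HasDerivWithinAt (γ N) (f (γ N t)) (Ici t) t := by
    intro N t ht
    refine ((hγ N t ⟨ht.1, ht.2.le⟩).mono (Icc_subset_Icc_left ht.1)).mono_of_mem_nhdsWithin ?_
    exact Icc_mem_nhdsGE ht.2
  have huniq : ∀ N M : ℕ, N ≤ M → EqOn (γ N) (γ M) (Icc 0 N) := by
    intro N M hNM
    have hNM' : (N : ℝ) ≤ M := by exact_mod_cast hNM
    refine ODE_solution_unique_of_mem_Icc_right (v := fun _ => f) (s := fun _ => univ) (K := K)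
      (fun _ _ => hf.lipschitzOnWith) (fun t ht => (hγ N t ht).continuousWithinAt)
      (hright N) (fun _ _ => mem_univ _)
      (fun t ht => ((hγ M t ⟨ht.1, ht.2.trans hNM'⟩).continuousWithinAt).mono
        (Icc_subset_Icc_right hNM'))
      (fun t ht => hright M t ⟨ht.1, ht.2.trans_le hNM'⟩) (fun _ _ => mem_univ _) ?_
    rw [hγ0, hγ0]
  -- Glue by uniqueness. The derivative at `t` is read off from the solution on `[0, ⌈t⌉₊ + 1]`,
  -- whose right endpoint lies strictly beyond `t`.
  refine ⟨fun t => γ (⌈t⌉₊) t, by simp [hγ0], fun t ht => ?_⟩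
  have ht1 : t < (⌈t⌉₊ + 1 : ℕ) := by
    push_cast
    exact (Nat.le_ceil t).trans_lt (lt_add_one _)
  have heq : ∀ s ∈ Icc (0 : ℝ) (⌈t⌉₊ + 1 : ℕ), γ (⌈s⌉₊) s = γ (⌈t⌉₊ + 1) s := fun s hs =>
    huniq _ _ (Nat.ceil_le.2 hs.2) ⟨hs.1, Nat.le_ceil s⟩
  have hd := hγ (⌈t⌉₊ + 1) t ⟨ht, ht1.le⟩
  rw [← heq t ⟨ht, ht1.le⟩] at hd
  refine (hd.congr heq (heq t ⟨ht, ht1.le⟩)).mono_of_mem_nhdsWithin ?_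
  rw [← Ici_inter_Iic]
  exact inter_mem self_mem_nhdsWithin (mem_nhdsWithin_of_mem_nhds (Iic_mem_nhds ht1))

/-- Gradient flow of a `C²` function with bounded sublevel set exists for all forward times. -/
theorem exists_gradient_flow_of_bounded_sublevel {E : Type*} [NormedAddCommGroup E]
    [InnerProductSpace ℝ E] [FiniteDimensional ℝ E] {L : E → ℝ} (hL : ContDiff ℝ 2 L)
    (x₀ : E) {R : ℝ} (hR : 0 < R) (hbd : ∀ x, L x ≤ L x₀ → ‖x‖ ≤ R) :
    ∃ γ : ℝ → E, γ 0 = x₀ ∧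
      ∀ t : ℝ, 0 ≤ t → HasDerivWithinAt γ (-gradient L (γ t)) (Ici 0) t := by
  have hgrad : ContDiff ℝ 1 (gradient L) := by
    unfold gradient
    exact (InnerProductSpace.toDual ℝ E).symm.contDiff.comp
      (hL.fderiv_right (m := 1) (by norm_num))
  -- The cutoff makes the field bounded and Lipschitz. A nonnegative multiple of `-∇L` still
  -- decreases `L`, so the curve stays in the ball where `χ = 1` and follows the true flow.
  let χ : ContDiffBump (0 : E) := ⟨R, R + 1, hR, by linarith⟩
  let v : E → E := fun x => χ x • (-gradient L x)
  have hv : ContDiff ℝ 1 v := χ.contDiff.smul hgrad.neg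
  have hvc : HasCompactSupport v := χ.hasCompactSupport.smul_right
  obtain ⟨K, hK⟩ := hv.lipschitzWith_of_hasCompactSupport hvc one_ne_zero
  obtain ⟨C, hC⟩ := hvc.exists_bound_of_continuous hv.continuous
  obtain ⟨γ, hγ0, hγ⟩ := exists_forward_integralCurve_of_lipschitzWith_of_bounded (L := C.toNNReal)
    hK (fun x => (hC x).trans (Real.le_coe_toNNReal C)) x₀
  have hdec : ∀ t : ℝ, 0 ≤ t → L (γ t) ≤ L x₀ := by
    intro t ht
    have hd : ∀ s : ℝ, 0 ≤ s →
        HasDerivWithinAt (fun s => L (γ s)) (fderiv ℝ L (γ s) (v (γ s))) (Ici 0) s := fun s hs =>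
      ((hL.differentiable two_ne_zero (γ s)).hasFDerivAt).comp_hasDerivWithinAt s (hγ s hs)
    have := image_le_of_deriv_right_le_deriv_boundary (a := 0) (b := t)
      (f := fun s => L (γ s)) (f' := fun s => fderiv ℝ L (γ s) (v (γ s)))
      (B := fun _ => L x₀) (B' := fun _ => 0)
      (fun s hs => ((hd s hs.1).continuousWithinAt).mono Icc_subset_Ici_self)
      (fun s hs => (hd s hs.1).mono (Ici_subset_Ici.2 hs.1)) (by simp [hγ0])
      continuousOn_const (fun s _ => hasDerivWithinAt_const _ _ _) ?_
    · exact this ⟨ht, le_rfl⟩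
    · intro s _
      have h1 : fderiv ℝ L (γ s) (v (γ s)) = -(χ (γ s) * ‖gradient L (γ s)‖ ^ 2) := by
        rw [← real_inner_self_eq_norm_sq]
        conv_rhs => rw [gradient]
        simp only [InnerProductSpace.toDual_symm_apply, v, map_smul, map_neg, smul_eq_mul]
        rw [gradient]
        ring
      rw [h1]
      have := χ.nonneg (x := γ s)
      have : 0 ≤ χ (γ s) * ‖gradient L (γ s)‖ ^ 2 := by positivity
      linarith
  refine ⟨γ, hγ0, fun t ht => ?_⟩
  have h1 : χ (γ t) = 1 := χ.one_of_mem_closedBall (by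
    simpa [χ] using hbd _ (hdec t ht))
  have := hγ t ht
  simpa only [v, h1, one_smul] using this

end GlobalExistence

/-! ### The gradient of the regularized loss. -/

noncomputable section

namespace MatrixCompletion

open Matrix

variable {d n : ℕ}

/-- The symmetrized sampling weights `(2 / n) (#{k | x k = (i, j)} + #{k | x k = (j, i)})`. -/
def weight (x : Fin n → Fin d × Fin d) (i j : Fin d) : ℝ :=
  2 / (n : ℝ) * ∑ k, ((if x k = (i, j) then 1 else 0) + (if x k = (j, i) then 1 else 0))

/-- The weighted residual `a ⊙ (W - X)`. -/
def residual (a : Fin d → Fin d → ℝ) (X W : Matrix (Fin d) (Fin d) ℝ) :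
    Matrix (Fin d) (Fin d) ℝ :=
  Matrix.of fun i j => a i j * (W i j - X i j)

theorem residual_apply (a : Fin d → Fin d → ℝ) (X W : Matrix (Fin d) (Fin d) ℝ) (i j : Fin d) :
    residual a X W i j = a i j * (W i j - X i j) := rfl

theorem weight_comm (x : Fin n → Fin d × Fin d) (i j : Fin d) : weight x i j = weight x j i := by
  simp only [weight, add_comm]

theorem sum_weight_mul (x : Fin n → Fin d × Fin d) (g : Fin d → Fin d → ℝ) :
    ∑ i, ∑ j, weight x i j * g i j =
      2 / (n : ℝ) * ∑ k, (g (x k).1 (x k).2 + g (x k).2 (x k).1) := by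
  have h1 : ∀ i j, weight x i j * g i j = 2 / (n : ℝ) * ∑ k,
      ((if x k = (i, j) then g i j else 0) + (if x k = (j, i) then g i j else 0)) := by
    intro i j
    rw [weight, mul_assoc, Finset.sum_mul]
    simp only [add_mul, ite_mul, one_mul, zero_mul]
  simp only [h1, ← Finset.mul_sum]
  congr 1
  rw [← Fintype.sum_prod_type' (fun i j => ∑ k,
    ((if x k = (i, j) then g i j else 0) + (if x k = (j, i) then g i j else 0))), Finset.sum_comm]
  refine Finset.sum_congr rfl fun k _ => ?_
  rw [Finset.sum_add_distrib]
  congr 1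
  · simp
  · rw [Finset.sum_eq_single ((x k).2, (x k).1)]
    · simp
    · rintro ⟨i, j⟩ _ hij
      rw [if_neg]
      intro h
      simp [h] at hij
    · simp

theorem matW_transpose (θ : Param d) : (matW θ)ᵀ = matW θ := by
  simp [matW, transpose_sub, transpose_mul]

theorem residual_transpose {a : Fin d → Fin d → ℝ} (ha : ∀ i j, a i j = a j i)
    {X W : Matrix (Fin d) (Fin d) ℝ} (hX : Xᵀ = X) (hW : Wᵀ = W) :
    (residual a X W)ᵀ = residual a X W := by
  ext i j
  rw [transpose_apply, residual_apply, residual_apply, ha j i]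
  conv_rhs => rw [← hX, ← hW]
  rfl

theorem sum_sum_mul_eq_trace (P M : Matrix (Fin d) (Fin d) ℝ) :
    ∑ i, ∑ j, P i j * M i j = trace (Pᵀ * M) := by
  rw [Finset.sum_comm]
  simp [trace, mul_apply]

theorem inner_pack (P Q : Matrix (Fin d) (Fin d) ℝ) (h : Param d) :
    inner ℝ (pack P Q) h = trace (Pᵀ * matU h) + trace (Qᵀ * matV h) := by
  rw [← sum_sum_mul_eq_trace, ← sum_sum_mul_eq_trace, PiLp.inner_apply]
  simp [pack, matU, matV, Fintype.sum_prod_type, mul_comm]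

theorem matU_add_smul (θ h : Param d) (s : ℝ) : matU (θ + s • h) = matU θ + s • matU h := rfl

theorem matV_add_smul (θ h : Param d) (s : ℝ) : matV (θ + s • h) = matV θ + s • matV h := rfl

theorem matU_pack (P Q : Matrix (Fin d) (Fin d) ℝ) : matU (pack P Q) = P := rfl

theorem matV_pack (P Q : Matrix (Fin d) (Fin d) ℝ) : matV (pack P Q) = Q := rfl

theorem pack_matU_matV (θ : Param d) : pack (matU θ) (matV θ) = θ := by
  ext q
  rcases q with ⟨i, j⟩ | ⟨i, j⟩ <;> rfl

/-- The derivative of `matW` at `θ` in the direction `h`. -/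
def dirW (θ h : Param d) : Matrix (Fin d) (Fin d) ℝ :=
  matU h * (matU θ)ᵀ + matU θ * (matU h)ᵀ - (matV h * (matV θ)ᵀ + matV θ * (matV h)ᵀ)

theorem dirW_transpose (θ h : Param d) : (dirW θ h)ᵀ = dirW θ h := by
  simp [dirW, transpose_sub, transpose_mul, add_comm]

theorem matW_add_smul (θ h : Param d) (s : ℝ) :
    matW (θ + s • h) = matW θ + s • dirW θ h + s ^ 2 • matW h := by
  simp only [matW, dirW, matU_add_smul, matV_add_smul, transpose_add, transpose_smul, add_mul,
    mul_add, smul_mul_assoc, mul_smul_comm, smul_sub, smul_add, smul_smul, pow_two]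
  abel

theorem contDiff_regLoss (X : Matrix (Fin d) (Fin d) ℝ) (x : Fin n → Fin d × Fin d) (lam : ℝ) :
    ContDiff ℝ 2 (regLoss X x lam) := by
  have hN : ContDiff ℝ 2 fun θ : Param d => ‖θ‖ ^ 2 := contDiff_norm_sq ℝ
  unfold regLoss modelOutput matW matU matV
  simp only [Matrix.sub_apply, mul_apply, of_apply, transpose_apply]
  fun_prop

theorem two_mul_trace_residual_mul {S : Matrix (Fin d) (Fin d) ℝ} (hS : Sᵀ = S) (θ h : Param d) :
    trace (Sᵀ * dirW θ h) =
      2 * (trace ((S * matU θ)ᵀ * matU h) - trace ((S * matV θ)ᵀ * matV h)) := by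
  have key : ∀ P Q : Matrix (Fin d) (Fin d) ℝ,
      trace (S * (Q * Pᵀ)) = trace ((S * P)ᵀ * Q) ∧ trace (S * (P * Qᵀ)) = trace ((S * P)ᵀ * Q) := by
    intro P Q
    constructor
    · rw [transpose_mul, hS, ← mul_assoc, trace_mul_comm, mul_assoc]
    · rw [← trace_transpose]
      simp only [transpose_mul, transpose_transpose, hS]
      rw [trace_mul_comm, mul_assoc, trace_mul_comm Pᵀ, mul_assoc]
  rw [hS, dirW, mul_sub, mul_add, mul_add, trace_sub, trace_add, trace_add,
    (key _ _).1, (key _ _).2, (key _ _).1, (key _ _).2]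
  ring

/-- Symmetrizing the weights is harmless because `W` and `X` are symmetric, and it makes `S`
symmetric. The two halves of `dirW` then pair equally with `S`, which cancels the factor `1/2` in
`hcoef`. -/
theorem gradient_regLoss {X : Matrix (Fin d) (Fin d) ℝ} (hX : X.IsSymm)
    (x : Fin n → Fin d × Fin d) (lam : ℝ) (θ : Param d) :
    gradient (regLoss X x lam) θ =
      pack (residual (weight x) X (matW θ) * matU θ + lam • matU θ)
        (-(residual (weight x) X (matW θ) * matV θ) + lam • matV θ) := by
  set S := residual (weight x) X (matW θ) with hSdef
  have hS : Sᵀ = S := residual_transpose (weight_comm x) hX (matW_transpose θ)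
  refine ext_inner_right ℝ fun h => ?_
  have hd : HasDerivAt (fun s : ℝ => regLoss X x lam (θ + s • h))
      (fderiv ℝ (regLoss X x lam) θ h) 0 := by
    have h1 : HasDerivAt (fun s : ℝ => θ + s • h) h 0 := by
      simpa using ((hasDerivAt_id (0 : ℝ)).smul_const h).const_add θ
    have h2 : HasFDerivAt (regLoss X x lam) (fderiv ℝ (regLoss X x lam) θ) (θ + (0 : ℝ) • h) := by
      rw [zero_smul, add_zero]
      exact ((contDiff_regLoss X x lam).differentiable two_ne_zero θ).hasFDerivAt
    exact h2.comp_hasDerivAt 0 h1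
  have hd' : HasDerivAt (fun s : ℝ => regLoss X x lam (θ + s • h))
      ((1 / (n : ℝ)) * ∑ k, 2 * (matW θ (x k).1 (x k).2 - X (x k).1 (x k).2) *
        dirW θ h (x k).1 (x k).2 + lam / 2 * (2 * inner ℝ θ h)) 0 := by
    have hm : ∀ i j, HasDerivAt (fun s : ℝ => (matW (θ + s • h) i j - X i j) ^ 2)
        (2 * (matW θ i j - X i j) * dirW θ h i j) 0 := by
      intro i j
      simp only [matW_add_smul, Matrix.add_apply, Matrix.smul_apply, smul_eq_mul]
      have h1 : HasDerivAt (fun s : ℝ => matW θ i j + s * dirW θ h i j + s ^ 2 * matW h i j - X i j)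
          (dirW θ h i j) 0 := by
        have := ((((hasDerivAt_id (0 : ℝ)).mul_const (dirW θ h i j)).const_add (matW θ i j)).add
          (((hasDerivAt_id (0 : ℝ)).pow 2).mul_const (matW h i j))).sub_const (X i j)
        exact this.congr_deriv (by simp)
      exact (h1.pow 2).congr_deriv (by simp)
    have hn : HasDerivAt (fun s : ℝ => ‖θ + s • h‖ ^ 2) (2 * inner ℝ θ h) 0 := by
      have h0 : ∀ s : ℝ, ‖θ + s • h‖ ^ 2 = ‖θ‖ ^ 2 + s * (2 * inner ℝ θ h) + s ^ 2 * ‖h‖ ^ 2 := by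
        intro s
        rw [norm_add_sq_real, inner_smul_right, norm_smul, mul_pow, Real.norm_eq_abs, sq_abs]
        ring
      simp only [h0]
      have := (((hasDerivAt_id (0 : ℝ)).mul_const (2 * inner ℝ θ h)).const_add (‖θ‖ ^ 2)).add
        (((hasDerivAt_id (0 : ℝ)).pow 2).mul_const (‖h‖ ^ 2))
      exact this.congr_deriv (by simp)
    exact ((HasDerivAt.fun_sum fun k _ => hm (x k).1 (x k).2).const_mul _).add (hn.const_mul _)
  have hcoef : (1 / (n : ℝ)) * ∑ k, 2 * (matW θ (x k).1 (x k).2 - X (x k).1 (x k).2) *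
      dirW θ h (x k).1 (x k).2 = trace (Sᵀ * dirW θ h) / 2 := by
    rw [← sum_sum_mul_eq_trace]
    simp only [hSdef, residual_apply, mul_assoc]
    rw [sum_weight_mul x (fun i j => (matW θ i j - X i j) * dirW θ h i j)]
    have hsym : ∀ i j, (matW θ j i - X j i) * dirW θ h j i =
        (matW θ i j - X i j) * dirW θ h i j := by
      intro i j
      have e1 : matW θ j i = matW θ i j := congrFun (congrFun (matW_transpose θ) i) j
      have e2 : X j i = X i j := congrFun (congrFun hX i) j
      have e3 : dirW θ h j i = dirW θ h i j := congrFun (congrFun (dirW_transpose θ h) i) j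
      rw [e1, e2, e3]
    simp only [hsym, ← two_mul, ← Finset.mul_sum]
    ring
  rw [gradient, InnerProductSpace.toDual_symm_apply, hd.unique hd', hcoef,
    two_mul_trace_residual_mul hS, inner_pack]
  conv_lhs => rw [← pack_matU_matV θ, inner_pack]
  simp only [matU_pack, matV_pack, transpose_add, transpose_neg, add_mul, neg_mul, trace_add,
    trace_neg, transpose_smul, smul_mul_assoc, trace_smul, smul_eq_mul]
  ring

theorem exists_isGradientFlow (X : Matrix (Fin d) (Fin d) ℝ) (x : Fin n → Fin d × Fin d)
    {lam : ℝ} (hlam : 0 < lam) (θ₀ : Param d) : ∃ θ, IsGradientFlow X x lam θ₀ θ := by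
  have hle : ∀ θ, lam / 2 * ‖θ‖ ^ 2 ≤ regLoss X x lam θ := by
    intro θ
    have : 0 ≤ (1 / (n : ℝ)) * ∑ k, (modelOutput θ (x k) - X (x k).1 (x k).2) ^ 2 := by positivity
    unfold regLoss
    linarith
  obtain ⟨γ, h0, hγ⟩ := exists_gradient_flow_of_bounded_sublevel (contDiff_regLoss X x lam) θ₀
    (R := Real.sqrt (2 * regLoss X x lam θ₀ / lam) + 1) (by positivity) (fun θ hθ => by
      have : ‖θ‖ ≤ Real.sqrt (2 * regLoss X x lam θ₀ / lam) := by
        refine Real.le_sqrt_of_sq_le ?_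
        rw [le_div_iff₀ hlam]
        linarith [hle θ]
      linarith)
  exact ⟨γ, h0, hγ⟩

-- Frobenius norm and Gram identities under `Pᵀ Q = 1`.

attribute [local instance] Matrix.frobeniusNormedAddCommGroup Matrix.frobeniusNormedSpace
  Matrix.frobeniusNormedRing Matrix.frobeniusNormedAlgebra

theorem frobenius_norm_sq (M : Matrix (Fin d) (Fin d) ℝ) : ‖M‖ ^ 2 = ∑ i, ∑ j, M i j ^ 2 := by
  rw [frobenius_norm_def, ← Real.sqrt_eq_rpow, Real.sq_sqrt (by positivity)]
  simp

theorem frobenius_norm_sq_eq_trace (M : Matrix (Fin d) (Fin d) ℝ) :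
    ‖M‖ ^ 2 = trace (Mᵀ * M) := by
  rw [frobenius_norm_sq, ← sum_sum_mul_eq_trace]
  simp only [pow_two]

theorem abs_apply_le_frobenius_norm (M : Matrix (Fin d) (Fin d) ℝ) (i j : Fin d) :
    |M i j| ≤ ‖M‖ := by
  refine abs_le_of_sq_le_sq ?_ (norm_nonneg _)
  rw [frobenius_norm_sq]
  calc M i j ^ 2 ≤ ∑ j', M i j' ^ 2 :=
        Finset.single_le_sum (f := fun j' => M i j' ^ 2) (fun _ _ => sq_nonneg _)
          (Finset.mem_univ j)
    _ ≤ ∑ i', ∑ j', M i' j' ^ 2 :=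
        Finset.single_le_sum (f := fun i' => ∑ j', M i' j' ^ 2)
          (fun _ _ => Finset.sum_nonneg fun _ _ => sq_nonneg _) (Finset.mem_univ i)

theorem hasDerivWithinAt_transpose {A : ℝ → Matrix (Fin d) (Fin d) ℝ}
    {A' : Matrix (Fin d) (Fin d) ℝ} {s : Set ℝ} {t : ℝ} (hA : HasDerivWithinAt A A' s t) :
    HasDerivWithinAt (fun t => (A t)ᵀ) A'ᵀ s t :=
  (LinearMap.toContinuousLinearMap
    (transposeLinearEquiv (Fin d) (Fin d) ℝ ℝ).toLinearMap).hasFDerivAt.comp_hasDerivWithinAt t hA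

theorem hasDerivWithinAt_entry {A : ℝ → Matrix (Fin d) (Fin d) ℝ}
    {A' : Matrix (Fin d) (Fin d) ℝ} {s : Set ℝ} {t : ℝ} (hA : HasDerivWithinAt A A' s t)
    (i j : Fin d) : HasDerivWithinAt (fun t => A t i j) (A' i j) s t :=
  (LinearMap.toContinuousLinearMap
    (entryLinearMap ℝ ℝ i j)).hasFDerivAt.comp_hasDerivWithinAt t hA

section Gram

variable {P Q : Matrix (Fin d) (Fin d) ℝ}

/-- The difference `P Pᵀ - Q Qᵀ`. -/
def gramDiff (P Q : Matrix (Fin d) (Fin d) ℝ) : Matrix (Fin d) (Fin d) ℝ := P * Pᵀ - Q * Qᵀ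

/-- The Gram matrix of `P - Q`. -/
def gap (P Q : Matrix (Fin d) (Fin d) ℝ) : Matrix (Fin d) (Fin d) ℝ := (P - Q) * (P - Q)ᵀ

theorem mul_transpose_eq_one (h : Pᵀ * Q = 1) : P * Qᵀ = 1 ∧ Q * Pᵀ = 1 := by
  have h1 : Q * Pᵀ = 1 := mul_eq_one_comm.1 h
  refine ⟨?_, h1⟩
  rw [← transpose_transpose P, ← transpose_mul, h1, transpose_one]

theorem gram_add_gram (h : Pᵀ * Q = 1) : P * Pᵀ + Q * Qᵀ = 2 + gap P Q := by
  obtain ⟨h1, h2⟩ := mul_transpose_eq_one h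
  rw [gap, transpose_sub, mul_sub, sub_mul, sub_mul, h1, h2, ← one_add_one_eq_two]
  abel

/-- With `M = P Pᵀ` and `N = Q Qᵀ` mutually inverse and `gap = M + N - 2`, both sides equal `M² + N²
- 2`. -/
theorem gramDiff_mul_self (h : Pᵀ * Q = 1) :
    gramDiff P Q * gramDiff P Q = (4 : ℝ) • gap P Q + gap P Q * gap P Q := by
  obtain ⟨h1, h2⟩ := mul_transpose_eq_one h
  have h3 : Qᵀ * P = 1 := mul_eq_one_comm.1 h1
  have e1 : P * Pᵀ * (Q * Qᵀ) = 1 := by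
    rw [mul_assoc, ← mul_assoc Pᵀ, h, one_mul, h1]
  have e2 : Q * Qᵀ * (P * Pᵀ) = 1 := by
    rw [mul_assoc, ← mul_assoc Qᵀ, h3, one_mul, h2]
  have e3 : gap P Q = P * Pᵀ + Q * Qᵀ - 2 := by rw [gram_add_gram h]; abel
  have e4 : (4 : ℝ) • gap P Q = gap P Q + gap P Q + (gap P Q + gap P Q) := by
    rw [← two_smul ℝ (gap P Q), ← two_smul ℝ ((2 : ℝ) • gap P Q), smul_smul]; norm_num
  rw [e4, e3, gramDiff]
  generalize P * Pᵀ = M at *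
  generalize Q * Qᵀ = N at *
  have : (2 : Matrix (Fin d) (Fin d) ℝ) = 1 + 1 := one_add_one_eq_two.symm
  rw [this]
  simp only [mul_sub, sub_mul, mul_add, add_mul, e1, e2, mul_one, one_mul]
  abel

theorem gramDiff_transpose : (gramDiff P Q)ᵀ = gramDiff P Q := by
  simp [gramDiff, transpose_sub, transpose_mul]

theorem gap_transpose : (gap P Q)ᵀ = gap P Q := by
  simp [gap, transpose_mul]

/-- Positive semidefiniteness bounds the norm of `gap` by its trace, and the trace of
`gramDiff_mul_self` controls the latter. -/
theorem norm_gap_le (h : Pᵀ * Q = 1) : ‖gap P Q‖ ≤ ‖gramDiff P Q‖ ^ 2 / 4 := by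
  have h1 : ‖gap P Q‖ ≤ trace (gap P Q) := by
    calc ‖gap P Q‖ ≤ ‖P - Q‖ * ‖(P - Q)ᵀ‖ := frobenius_norm_mul _ _
      _ = trace (gap P Q) := by
        rw [frobenius_norm_transpose, ← pow_two, frobenius_norm_sq_eq_trace, trace_mul_comm, gap]
  have h2 : ‖gramDiff P Q‖ ^ 2 = 4 * trace (gap P Q) + ‖gap P Q‖ ^ 2 := by
    rw [frobenius_norm_sq_eq_trace, gramDiff_transpose, gramDiff_mul_self h,
      frobenius_norm_sq_eq_trace, gap_transpose, trace_add, trace_smul, smul_eq_mul]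
  nlinarith [sq_nonneg ‖gap P Q‖]

/-- The `gap` terms contribute `2‖(P - Q)ᵀ S‖² ≥ 0`, so they can only accelerate the decay of the
error. -/
theorem four_mul_norm_sq_le_trace {S : Matrix (Fin d) (Fin d) ℝ} (hS : Sᵀ = S) :
    4 * ‖S‖ ^ 2 ≤ trace (Sᵀ * (S * (2 + gap P Q) + (2 + gap P Q) * S)) := by
  have h1 : trace (S * (S * gap P Q)) = ‖(P - Q)ᵀ * S‖ ^ 2 := by
    rw [frobenius_norm_sq_eq_trace, transpose_mul, transpose_transpose, hS, gap, ← mul_assoc,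
      trace_mul_comm, ← mul_assoc, trace_mul_comm, ← mul_assoc]
    simp only [mul_assoc]
  have h2 : trace (S * (gap P Q * S)) = trace (S * (S * gap P Q)) := by
    rw [trace_mul_comm, mul_assoc, trace_mul_comm, mul_assoc]
  have h3 : trace (S * (S * 2)) = 2 * ‖S‖ ^ 2 := by
    rw [frobenius_norm_sq_eq_trace, hS, ← one_add_one_eq_two, mul_add, mul_one, mul_add, trace_add]
    ring
  have h4 : trace (S * (2 * S)) = 2 * ‖S‖ ^ 2 := by
    rw [frobenius_norm_sq_eq_trace, hS, ← one_add_one_eq_two, add_mul, one_mul, mul_add, trace_add]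
    ring
  rw [hS, mul_add S 2, add_mul 2, mul_add, mul_add, mul_add, trace_add, trace_add, trace_add, h2,
    h1, h3, h4]
  nlinarith [sq_nonneg ‖(P - Q)ᵀ * S‖]

end Gram

/-! ### The rescaled flow and its deviation from linear dynamics. -/

/-- The pair `(A, B)` solves `A' = -S A`, `B' = S B` on `[0, ∞)` from `A 0 = B 0 = 1`, where `S` is
a curve of symmetric matrices. -/
structure IsRescaledFlow (S A B : ℝ → Matrix (Fin d) (Fin d) ℝ) : Prop where
  symm : ∀ t : ℝ, 0 ≤ t → (S t)ᵀ = S t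
  left_zero : A 0 = 1
  right_zero : B 0 = 1
  left_deriv : ∀ t : ℝ, 0 ≤ t → HasDerivWithinAt A (-(S t * A t)) (Set.Ici 0) t
  right_deriv : ∀ t : ℝ, 0 ≤ t → HasDerivWithinAt B (S t * B t) (Set.Ici 0) t

namespace IsRescaledFlow

variable {S A B : ℝ → Matrix (Fin d) (Fin d) ℝ}

theorem transpose_mul_eq_one (hf : IsRescaledFlow S A B) {t : ℝ} (ht : 0 ≤ t) :
    (A t)ᵀ * B t = 1 := by
  have hd : ∀ s : ℝ, 0 ≤ s → HasDerivWithinAt (fun s => (A s)ᵀ * B s) 0 (Set.Ici 0) s := by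
    intro s hs
    refine ((hasDerivWithinAt_transpose (hf.left_deriv s hs)).mul
      (hf.right_deriv s hs)).congr_deriv ?_
    rw [transpose_neg, transpose_mul, hf.symm s hs, neg_mul, mul_assoc]
    exact neg_add_cancel _
  have := constant_of_has_deriv_right_zero (a := 0) (b := t)
    (fun s hs => ((hd s hs.1).continuousWithinAt).mono Set.Icc_subset_Ici_self)
    (fun s hs => (hd s hs.1).mono (Set.Ici_subset_Ici.2 hs.1)) t ⟨ht, le_rfl⟩
  rw [this, hf.left_zero, hf.right_zero, transpose_one, mul_one]

theorem hasDerivWithinAt_gramDiff (hf : IsRescaledFlow S A B) {t : ℝ} (ht : 0 ≤ t) :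
    HasDerivWithinAt (fun t => gramDiff (A t) (B t))
      (-(S t * (2 + gap (A t) (B t)) + (2 + gap (A t) (B t)) * S t)) (Set.Ici 0) t := by
  have hA := hf.left_deriv t ht
  have hB := hf.right_deriv t ht
  refine ((hA.mul (hasDerivWithinAt_transpose hA)).sub
    (hB.mul (hasDerivWithinAt_transpose hB))).congr_deriv ?_
  rw [← gram_add_gram (hf.transpose_mul_eq_one ht)]
  simp only [transpose_neg, transpose_mul, hf.symm t ht, mul_add, add_mul, neg_mul, mul_neg,
    mul_assoc]
  abel

theorem gramDiff_zero (hf : IsRescaledFlow S A B) : gramDiff (A 0) (B 0) = 0 := by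
  rw [gramDiff, hf.left_zero, hf.right_zero, sub_self]

/-- A barrier argument: at a contact with `8 G ≤ 1`, `‖gap‖ ≤ 1/4`, so the speed is at most `(4 +
1/2) g < 8 g`. -/
theorem norm_gramDiff_le (hf : IsRescaledFlow S A B) {g G : ℝ → ℝ} {T : ℝ}
    (hG : ∀ t, HasDerivAt G (g t) t) (hg : ∀ t, 0 < g t) (hG0 : G 0 = 0)
    (hS : ∀ t ∈ Set.Icc 0 T, ‖S t‖ ≤ g t) (hT : 8 * G T ≤ 1) :
    ∀ t ∈ Set.Icc 0 T, ‖gramDiff (A t) (B t)‖ ≤ 8 * G t := by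
  have hmono : StrictMono G := strictMono_of_hasDerivAt_pos hG hg
  refine image_norm_le_of_norm_deriv_right_lt_deriv_boundary (B := fun t => 8 * G t)
    (B' := fun t => 8 * g t)
    (fun t ht => ((hf.hasDerivWithinAt_gramDiff ht.1).continuousWithinAt).mono
      Set.Icc_subset_Ici_self)
    (fun t ht => (hf.hasDerivWithinAt_gramDiff ht.1).mono (Set.Ici_subset_Ici.2 ht.1))
    (by rw [hf.gramDiff_zero, hG0]; simp) (fun t => (hG t).const_mul 8) ?_
  intro t ht heq
  have h1 : ‖gramDiff (A t) (B t)‖ ≤ 1 := by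
    rw [heq]
    linarith [hmono.monotone ht.2.le]
  have h2 : ‖gap (A t) (B t)‖ ≤ 1 / 4 := by
    have := norm_gap_le (hf.transpose_mul_eq_one ht.1)
    nlinarith [norm_nonneg (gramDiff (A t) (B t))]
  have h3 := hS t ⟨ht.1, ht.2.le⟩
  have h4 := hg t
  have h5 : S t * (2 + gap (A t) (B t)) + (2 + gap (A t) (B t)) * S t =
      (4 : ℝ) • S t + (S t * gap (A t) (B t) + gap (A t) (B t) * S t) := by
    have e : (4 : ℝ) • S t = S t + S t + (S t + S t) := by
      rw [← two_smul ℝ (S t), ← two_smul ℝ ((2 : ℝ) • S t), smul_smul]; norm_num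
    rw [e, mul_add, add_mul, ← one_add_one_eq_two, mul_add, add_mul, mul_one, one_mul]
    abel
  rw [norm_neg, h5]
  have h6 : ‖S t * gap (A t) (B t)‖ ≤ g t * (1 / 4) :=
    (norm_mul_le _ _).trans (mul_le_mul h3 h2 (norm_nonneg _) h4.le)
  have h7 : ‖gap (A t) (B t) * S t‖ ≤ 1 / 4 * g t :=
    (norm_mul_le _ _).trans (mul_le_mul h2 h3 (norm_nonneg _) (by norm_num))
  have h8 : ‖(4 : ℝ) • S t‖ ≤ 4 * g t := by
    rw [norm_smul]
    norm_num
    exact h3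
  have h9 := norm_add_le ((4 : ℝ) • S t) (S t * gap (A t) (B t) + gap (A t) (B t) * S t)
  have h10 := norm_add_le (S t * gap (A t) (B t)) (gap (A t) (B t) * S t)
  linarith

/-- Where `S` vanishes, so does the linear part of the derivative. The two remaining products are
each at most `g (8 G)² / 4 = 16 g G²`, and integrating gives the cube. -/
theorem abs_gramDiff_apply_le (hf : IsRescaledFlow S A B) {g G : ℝ → ℝ} {T : ℝ}
    (hG : ∀ t, HasDerivAt G (g t) t) (hg : ∀ t, 0 < g t) (hG0 : G 0 = 0)
    (hS : ∀ t ∈ Set.Icc 0 T, ‖S t‖ ≤ g t) (hT0 : 0 ≤ T) (hT : 8 * G T ≤ 1) {i j : Fin d}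
    (hij : ∀ t, S t i j = 0) :
    |gramDiff (A T) (B T) i j| ≤ 32 * G T ^ 3 := by
  have hmono : StrictMono G := strictMono_of_hasDerivAt_pos hG hg
  have hZ := hf.norm_gramDiff_le hG hg hG0 hS hT
  have hd := fun (t : ℝ) (ht : 0 ≤ t) =>
    hasDerivWithinAt_entry (hf.hasDerivWithinAt_gramDiff ht) i j
  have := image_norm_le_of_norm_deriv_right_le_deriv_boundary (a := 0) (b := T)
    (B := fun t => 32 * G T ^ 2 * G t) (B' := fun t => 32 * G T ^ 2 * g t)
    (fun t ht => ((hd t ht.1).continuousWithinAt).mono Set.Icc_subset_Ici_self)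
    (fun t ht => (hd t ht.1).mono (Set.Ici_subset_Ici.2 ht.1))
    (by rw [hf.gramDiff_zero, hG0]; simp) (fun t => (hG t).const_mul _) ?_ ⟨hT0, le_rfl⟩
  · rw [Real.norm_eq_abs] at this
    refine this.trans_eq ?_
    ring
  · intro t ht
    have h3 := hS t ⟨ht.1, ht.2.le⟩
    have h4 := hg t
    have hGt : 0 ≤ G t := by
      rw [← hG0]
      exact hmono.monotone ht.1
    have h2 : ‖gap (A t) (B t)‖ ≤ 16 * G T ^ 2 := by
      have h := norm_gap_le (hf.transpose_mul_eq_one ht.1)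
      have h' := hZ t ⟨ht.1, ht.2.le⟩
      have h'' := hmono.monotone ht.2.le
      nlinarith [norm_nonneg (gramDiff (A t) (B t))]
    have h5 : (-(S t * (2 + gap (A t) (B t)) + (2 + gap (A t) (B t)) * S t)) i j =
        -((S t * gap (A t) (B t) + gap (A t) (B t) * S t) i j) := by
      rw [mul_add, add_mul, ← one_add_one_eq_two, mul_add, add_mul, mul_one, one_mul]
      simp only [Matrix.neg_apply, Matrix.add_apply, hij t]
      ring
    rw [h5, Real.norm_eq_abs, abs_neg]
    have h6 : ‖S t * gap (A t) (B t)‖ ≤ g t * (16 * G T ^ 2) :=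
      (norm_mul_le _ _).trans (mul_le_mul h3 h2 (norm_nonneg _) h4.le)
    have h7 : ‖gap (A t) (B t) * S t‖ ≤ 16 * G T ^ 2 * g t :=
      (norm_mul_le _ _).trans (mul_le_mul h2 h3 (norm_nonneg _) (by positivity))
    have h8 := abs_apply_le_frobenius_norm (S t * gap (A t) (B t) + gap (A t) (B t) * S t) i j
    have h10 := norm_add_le (S t * gap (A t) (B t)) (gap (A t) (B t) * S t)
    linarith

end IsRescaledFlow

/-! ### Decay of the weighted error. -/

/-- The weighted squared error `∑ a i j (W i j - X i j)²`. -/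
def weightedError (a : Fin d → Fin d → ℝ) (X W : Matrix (Fin d) (Fin d) ℝ) : ℝ :=
  ∑ i, ∑ j, a i j * (W i j - X i j) ^ 2

theorem norm_residual_sq_le {a : Fin d → Fin d → ℝ} {K : ℝ} (ha : ∀ i j, a i j ^ 2 ≤ K * a i j)
    (X W : Matrix (Fin d) (Fin d) ℝ) : ‖residual a X W‖ ^ 2 ≤ K * weightedError a X W := by
  rw [frobenius_norm_sq, weightedError, Finset.mul_sum]
  refine Finset.sum_le_sum fun i _ => ?_
  rw [Finset.mul_sum]
  refine Finset.sum_le_sum fun j _ => ?_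
  rw [residual_apply, mul_pow, ← mul_assoc]
  exact mul_le_mul_of_nonneg_right (ha i j) (sq_nonneg _)

theorem le_norm_residual_sq {a : Fin d → Fin d → ℝ} {κ : ℝ} (ha : ∀ i j, κ * a i j ≤ a i j ^ 2)
    (X W : Matrix (Fin d) (Fin d) ℝ) : κ * weightedError a X W ≤ ‖residual a X W‖ ^ 2 := by
  rw [frobenius_norm_sq, weightedError, Finset.mul_sum]
  refine Finset.sum_le_sum fun i _ => ?_
  rw [Finset.mul_sum]
  refine Finset.sum_le_sum fun j _ => ?_
  rw [residual_apply, mul_pow, ← mul_assoc]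
  exact mul_le_mul_of_nonneg_right (ha i j) (sq_nonneg _)

/-- Write `W = (W - X) + X` entrywise: the first part has a favourable sign, and the second is
handled by completing the square. The coefficient `4 m` uses up half of the dissipation `8 m ‖S‖²`.
-/
theorem neg_trace_residual_mul_le {a : Fin d → Fin d → ℝ} (ha : ∀ i j, 0 ≤ a i j)
    (X W : Matrix (Fin d) (Fin d) ℝ) {lam m : ℝ} (hlam : 0 ≤ lam) (hm : 0 < m) :
    -(4 * lam * trace ((residual a X W)ᵀ * W)) ≤
      4 * m * ‖residual a X W‖ ^ 2 + lam ^ 2 / m * ‖X‖ ^ 2 := by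
  rw [← sum_sum_mul_eq_trace, frobenius_norm_sq, frobenius_norm_sq, Finset.mul_sum, Finset.mul_sum,
    Finset.mul_sum, ← Finset.sum_neg_distrib, ← Finset.sum_add_distrib]
  refine Finset.sum_le_sum fun i _ => ?_
  rw [Finset.mul_sum, Finset.mul_sum, Finset.mul_sum, ← Finset.sum_neg_distrib,
    ← Finset.sum_add_distrib]
  refine Finset.sum_le_sum fun j _ => ?_
  rw [residual_apply]
  have h1 : 0 ≤ lam * (a i j * (W i j - X i j) ^ 2) :=
    mul_nonneg hlam (mul_nonneg (ha i j) (sq_nonneg _))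
  have h2 : 4 * m * (a i j * (W i j - X i j)) ^ 2 + lam ^ 2 / m * X i j ^ 2 =
      m * (2 * (a i j * (W i j - X i j)) + lam / m * X i j) ^ 2 -
        4 * lam * (a i j * (W i j - X i j)) * X i j := by
    field_simp
    ring
  rw [h2]
  have h3 : 0 ≤ m * (2 * (a i j * (W i j - X i j)) + lam / m * X i j) ^ 2 := by positivity
  nlinarith

/-- Exponential decay of the weighted error along the flow, up to the bias of the weight decay. -/
theorem weightedError_le {a : Fin d → Fin d → ℝ} {X : Matrix (Fin d) (Fin d) ℝ}
    {A B : ℝ → Matrix (Fin d) (Fin d) ℝ} {μ : ℝ → ℝ} {κ D lam m T : ℝ}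
    (ha0 : ∀ i j, 0 ≤ a i j) (haκ : ∀ i j, κ * a i j ≤ a i j ^ 2)
    (hlam : 0 < lam) (hm : 0 < m)
    (hμ : ∀ t, HasDerivAt μ (-(2 * lam * μ t)) t) (hμm : ∀ t ∈ Set.Icc 0 T, m ≤ μ t)
    (hf : IsRescaledFlow (fun t => residual a X (μ t • gramDiff (A t) (B t))) A B)
    (hD0 : weightedError a X 0 ≤ D ^ 2) (hDX : ‖X‖ ^ 2 < 4 * κ * D ^ 2) :
    ∀ t ∈ Set.Icc 0 T, weightedError a X (μ t • gramDiff (A t) (B t)) ≤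
      D ^ 2 * (Real.exp (-(4 * m * κ * t)) + lam ^ 2 / m ^ 2) := by
  set W : ℝ → Matrix (Fin d) (Fin d) ℝ := fun t => μ t • gramDiff (A t) (B t) with hW
  set S : ℝ → Matrix (Fin d) (Fin d) ℝ := fun t => residual a X (W t) with hS
  set W' : ℝ → Matrix (Fin d) (Fin d) ℝ := fun t => -((2 * lam) • W t) - μ t •
    (S t * (2 + gap (A t) (B t)) + (2 + gap (A t) (B t)) * S t) with hW'
  have hWd : ∀ t : ℝ, 0 ≤ t → HasDerivWithinAt W (W' t) (Set.Ici 0) t := by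
    intro t ht
    refine ((hμ t).hasDerivWithinAt.smul (hf.hasDerivWithinAt_gramDiff ht)).congr_deriv ?_
    simp only [hW', hW, smul_smul, smul_neg, neg_smul]
    abel
  have hφd : ∀ t : ℝ, 0 ≤ t → HasDerivWithinAt (fun t => weightedError a X (W t))
      (2 * trace ((S t)ᵀ * W' t)) (Set.Ici 0) t := by
    intro t ht
    have h1 : ∀ i j, HasDerivWithinAt (fun t => a i j * (W t i j - X i j) ^ 2)
        (a i j * (2 * (W t i j - X i j) * W' t i j)) (Set.Ici 0) t := fun i j =>
      (((((hasDerivWithinAt_entry (hWd t ht) i j).sub_const (X i j)).pow 2).congr_deriv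
        (by simp)).const_mul (a i j))
    have h2 := HasDerivWithinAt.fun_sum (u := Finset.univ) fun i _ =>
      HasDerivWithinAt.fun_sum (u := Finset.univ) fun j _ => h1 i j
    refine h2.congr_deriv ?_
    rw [← sum_sum_mul_eq_trace, Finset.mul_sum]
    refine Finset.sum_congr rfl fun i _ => ?_
    rw [Finset.mul_sum]
    refine Finset.sum_congr rfl fun j _ => ?_
    simp only [hS, residual_apply]
    ring
  have hbound : ∀ t ∈ Set.Icc 0 T, 2 * trace ((S t)ᵀ * W' t) ≤
      -(4 * m * κ * weightedError a X (W t)) + lam ^ 2 / m * ‖X‖ ^ 2 := by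
    intro t ht
    have h1 := four_mul_norm_sq_le_trace (P := A t) (Q := B t) (hf.symm t ht.1)
    have h2 := neg_trace_residual_mul_le ha0 X (W t) hlam.le hm
    have h3 := le_norm_residual_sq haκ X (W t)
    have h4 := hμm t ht
    have h5 : 2 * trace ((S t)ᵀ * W' t) = -(4 * lam * trace ((S t)ᵀ * W t)) - 2 * μ t *
        trace ((S t)ᵀ * (S t * (2 + gap (A t) (B t)) + (2 + gap (A t) (B t)) * S t)) := by
      simp only [hW', mul_sub, mul_neg, mul_smul_comm, trace_sub, trace_neg, trace_smul,
        smul_eq_mul]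
      ring
    rw [h5]
    have h6 : 8 * m * ‖S t‖ ^ 2 ≤ 2 * μ t *
        trace ((S t)ᵀ * (S t * (2 + gap (A t) (B t)) + (2 + gap (A t) (B t)) * S t)) := by
      calc 8 * m * ‖S t‖ ^ 2 = 2 * m * (4 * ‖S t‖ ^ 2) := by ring
        _ ≤ 2 * μ t * (4 * ‖S t‖ ^ 2) := by gcongr
        _ ≤ _ := mul_le_mul_of_nonneg_left h1 (by linarith)
    have h7 : 4 * m * (κ * weightedError a X (W t)) ≤ 4 * m * ‖S t‖ ^ 2 :=
      mul_le_mul_of_nonneg_left h3 (by positivity)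
    linarith
  refine image_le_of_deriv_right_lt_deriv_boundary
    (B := fun t => D ^ 2 * (Real.exp (-(4 * m * κ * t)) + lam ^ 2 / m ^ 2))
    (B' := fun t => D ^ 2 * (Real.exp (-(4 * m * κ * t)) * (-(4 * m * κ))))
    (fun t ht => ((hφd t ht.1).continuousWithinAt).mono Set.Icc_subset_Ici_self)
    (fun t ht => (hφd t ht.1).mono (Set.Ici_subset_Ici.2 ht.1)) ?_ ?_ ?_
  · have h0 : W 0 = 0 := by rw [hW]; simp only [hf.gramDiff_zero, smul_zero]
    simp only [h0, mul_zero, neg_zero, Real.exp_zero]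
    have : 0 ≤ D ^ 2 * (lam ^ 2 / m ^ 2) := by positivity
    linarith
  · intro t
    refine ((((hasDerivAt_id t).const_mul (4 * m * κ)).neg.exp).add_const _).const_mul _
      |>.congr_deriv ?_
    simp
  -- At contact with the barrier, the strict bound `‖X‖² < 4κD²` makes the error grow strictly
  -- slower than the barrier.
  · intro t ht heq
    refine (hbound t ⟨ht.1, ht.2.le⟩).trans_lt ?_
    rw [heq]
    have h1 : lam ^ 2 / m * ‖X‖ ^ 2 < lam ^ 2 / m * (4 * κ * D ^ 2) :=
      mul_lt_mul_of_pos_left hDX (by positivity)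
    have h2 : 4 * m * κ * (D ^ 2 * (Real.exp (-(4 * m * κ * t)) + lam ^ 2 / m ^ 2)) =
        D ^ 2 * (Real.exp (-(4 * m * κ * t)) * (4 * m * κ)) + lam ^ 2 / m * (4 * κ * D ^ 2) := by
      field_simp
    linarith

/-! ### From gradient flow to the rescaled flow. -/

theorem hasDerivWithinAt_matU {θ : ℝ → Param d} {θ' : Param d} {s : Set ℝ} {t : ℝ}
    (h : HasDerivWithinAt θ θ' s t) :
    HasDerivWithinAt (fun t => matU (θ t)) (matU θ') s t :=
  (LinearMap.toContinuousLinearMap (⟨⟨matU, fun _ _ => rfl⟩, fun _ _ => rfl⟩ :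
    Param d →ₗ[ℝ] Matrix (Fin d) (Fin d) ℝ)).hasFDerivAt.comp_hasDerivWithinAt t h

theorem hasDerivWithinAt_matV {θ : ℝ → Param d} {θ' : Param d} {s : Set ℝ} {t : ℝ}
    (h : HasDerivWithinAt θ θ' s t) :
    HasDerivWithinAt (fun t => matV (θ t)) (matV θ') s t :=
  (LinearMap.toContinuousLinearMap (⟨⟨matV, fun _ _ => rfl⟩, fun _ _ => rfl⟩ :
    Param d →ₗ[ℝ] Matrix (Fin d) (Fin d) ℝ)).hasFDerivAt.comp_hasDerivWithinAt t h

/-- Division of a parameter block by the decaying scale `α e^{-lam t}`. -/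
def rescale (lam α : ℝ) (M : ℝ → Matrix (Fin d) (Fin d) ℝ) (t : ℝ) : Matrix (Fin d) (Fin d) ℝ :=
  (α⁻¹ * Real.exp (lam * t)) • M t

/-- The squared scale `α² e^{-2 lam t}`. -/
def sqScale (lam α t : ℝ) : ℝ := α ^ 2 * Real.exp (-(2 * lam * t))

theorem hasDerivAt_sqScale (lam α t : ℝ) :
    HasDerivAt (sqScale lam α) (-(2 * lam * sqScale lam α t)) t := by
  refine (((hasDerivAt_id t).const_mul (2 * lam)).neg.exp.const_mul (α ^ 2)).congr_deriv ?_
  simp [sqScale]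
  ring

theorem sqScale_smul_gramDiff {lam α : ℝ} (hα : α ≠ 0) (θ : ℝ → Param d) (t : ℝ) :
    sqScale lam α t • gramDiff (rescale lam α (fun t => matU (θ t)) t)
      (rescale lam α (fun t => matV (θ t)) t) = matW (θ t) := by
  have h1 : sqScale lam α t * ((α⁻¹ * Real.exp (lam * t)) * (α⁻¹ * Real.exp (lam * t))) = 1 := by
    have : Real.exp (-(2 * lam * t)) * (Real.exp (lam * t) * Real.exp (lam * t)) = 1 := by
      rw [← Real.exp_add, ← Real.exp_add, Real.exp_eq_one_iff]
      ring
    calc _ = (α * α⁻¹) ^ 2 * (Real.exp (-(2 * lam * t)) *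
          (Real.exp (lam * t) * Real.exp (lam * t))) := by rw [sqScale]; ring
      _ = 1 := by rw [this, mul_inv_cancel₀ hα]; ring
  simp only [gramDiff, rescale, transpose_smul, smul_mul_assoc, mul_smul_comm, smul_sub, smul_smul]
  rw [h1, one_smul, one_smul, matW]

theorem IsGradientFlow.isRescaledFlow {X : Matrix (Fin d) (Fin d) ℝ} (hX : X.IsSymm)
    {x : Fin n → Fin d × Fin d} {lam α : ℝ} (hα : α ≠ 0) {θ : ℝ → Param d}
    (hθ : IsGradientFlow X x lam (α • initDir d) θ) :
    IsRescaledFlow (fun t => residual (weight x) X (sqScale lam α t •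
        gramDiff (rescale lam α (fun t => matU (θ t)) t) (rescale lam α (fun t => matV (θ t)) t)))
      (rescale lam α fun t => matU (θ t)) (rescale lam α fun t => matV (θ t)) := by
  simp only [sqScale_smul_gramDiff hα]
  have hr : ∀ t, HasDerivAt (fun t => α⁻¹ * Real.exp (lam * t))
      (lam * (α⁻¹ * Real.exp (lam * t))) t := by
    intro t
    refine (((hasDerivAt_id t).const_mul lam).exp.const_mul α⁻¹).congr_deriv ?_
    simp
    ring
  refine ⟨fun t _ => residual_transpose (weight_comm x) hX (matW_transpose _), ?_, ?_, ?_, ?_⟩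
  · have : matU (θ 0) = α • 1 := by rw [hθ.1]; rfl
    simp [rescale, this, smul_smul, hα]
  · have : matV (θ 0) = α • 1 := by rw [hθ.1]; rfl
    simp [rescale, this, smul_smul, hα]
  · intro t ht
    have h1 := hasDerivWithinAt_matU (hθ.2 t ht)
    rw [gradient_regLoss hX] at h1
    refine ((hr t).hasDerivWithinAt.smul h1).congr_deriv ?_
    have : matU (-pack (residual (weight x) X (matW (θ t)) * matU (θ t) + lam • matU (θ t))
        (-(residual (weight x) X (matW (θ t)) * matV (θ t)) + lam • matV (θ t))) =
        -(residual (weight x) X (matW (θ t)) * matU (θ t) + lam • matU (θ t)) := rfl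
    rw [this, rescale, mul_smul_comm, smul_neg, smul_add, smul_smul, mul_comm lam (_ * _)]
    abel
  · intro t ht
    have h1 := hasDerivWithinAt_matV (hθ.2 t ht)
    rw [gradient_regLoss hX] at h1
    refine ((hr t).hasDerivWithinAt.smul h1).congr_deriv ?_
    have : matV (-pack (residual (weight x) X (matW (θ t)) * matU (θ t) + lam • matU (θ t))
        (-(residual (weight x) X (matW (θ t)) * matV (θ t)) + lam • matV (θ t))) =
        -(-(residual (weight x) X (matW (θ t)) * matV (θ t)) + lam • matV (θ t)) := rfl
    rw [this, rescale, mul_smul_comm, smul_neg, smul_add, smul_smul, mul_comm lam (_ * _), smul_neg]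
    abel

/-! ### Sampling weights and quantitative error bounds. -/

theorem weight_eq_cast (x : Fin n → Fin d × Fin d) (i j : Fin d) :
    weight x i j = 2 / (n : ℝ) *
      ((∑ k, ((if x k = (i, j) then 1 else 0) + (if x k = (j, i) then 1 else 0)) : ℕ) : ℝ) := by
  rw [weight]
  push_cast
  rfl

theorem weight_nonneg (x : Fin n → Fin d × Fin d) (i j : Fin d) : 0 ≤ weight x i j := by
  rw [weight_eq_cast]
  positivity

theorem weight_le_four (hn : 0 < n) (x : Fin n → Fin d × Fin d) (i j : Fin d) :
    weight x i j ≤ 4 := by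
  have hn' : (0 : ℝ) < n := by exact_mod_cast hn
  have h1 : ∑ k, (((if x k = (i, j) then 1 else 0) + (if x k = (j, i) then 1 else 0)) : ℝ) ≤
      ∑ _k : Fin n, (2 : ℝ) := by
    refine Finset.sum_le_sum fun k _ => ?_
    split_ifs <;> norm_num
  calc weight x i j ≤ 2 / (n : ℝ) * ∑ _k : Fin n, (2 : ℝ) := by
        rw [weight]
        gcongr
    _ = 4 := by
        simp
        field_simp
        norm_num

/-- Weights are natural multiples of `2 / n`, so each is zero or at least `2 / n`. -/
theorem mul_weight_le_sq (x : Fin n → Fin d × Fin d) (i j : Fin d) :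
    2 / (n : ℝ) * weight x i j ≤ weight x i j ^ 2 := by
  rw [weight_eq_cast]
  generalize (∑ k, ((if x k = (i, j) then 1 else 0) + (if x k = (j, i) then 1 else 0)) : ℕ) = N
  have h1 : (N : ℝ) ≤ (N : ℝ) ^ 2 := by exact_mod_cast Nat.le_self_pow two_ne_zero N
  calc 2 / (n : ℝ) * (2 / (n : ℝ) * N) = (2 / (n : ℝ)) ^ 2 * N := by ring
    _ ≤ (2 / (n : ℝ)) ^ 2 * (N : ℝ) ^ 2 := by gcongr
    _ = _ := by ring

theorem weight_pos (hn : 0 < n) {x : Fin n → Fin d × Fin d} {i j : Fin d}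
    (h : (i, j) ∈ observed x ∨ (j, i) ∈ observed x) : 0 < weight x i j := by
  have hn' : (0 : ℝ) < n := by exact_mod_cast hn
  rw [weight]
  refine mul_pos (by positivity) (Finset.sum_pos' (fun k _ => ?_) ?_)
  · split_ifs <;> norm_num
  · simp only [observed, Finset.mem_image, Finset.mem_univ, true_and] at h
    rcases h with ⟨k, hk⟩ | ⟨k, hk⟩
    · refine ⟨k, Finset.mem_univ _, ?_⟩
      rw [if_pos hk]
      split_ifs <;> norm_num
    · refine ⟨k, Finset.mem_univ _, ?_⟩
      rw [if_pos hk]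
      split_ifs <;> norm_num

theorem weight_eq_zero {x : Fin n → Fin d × Fin d} {i j : Fin d}
    (h : ¬((i, j) ∈ observed x ∨ (j, i) ∈ observed x)) : weight x i j = 0 := by
  simp only [observed, Finset.mem_image, Finset.mem_univ, true_and, not_or, not_exists] at h
  simp [weight, h.1, h.2]

/-- Error of gradient flow from `α (I, I)` on the observed and unobserved entries at time `T`,
with constants depending only on the target and on the sample. -/
theorem exists_error_bounds (hn : 0 < n) {X : Matrix (Fin d) (Fin d) ℝ} (hX : X.IsSymm)
    (x : Fin n → Fin d × Fin d) :
    ∃ D H κ : ℝ, 0 < H ∧ 0 < κ ∧ ∀ (lam α T : ℝ) (θ : ℝ → Param d), 0 < lam → 0 < α → 0 ≤ T →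
      IsGradientFlow X x lam (α • initDir d) θ →
      weightedError (weight x) X (matW (θ T)) ≤ D ^ 2 *
        (Real.exp (-(4 * sqScale lam α T * κ * T)) + lam ^ 2 / sqScale lam α T ^ 2) ∧
      ∀ i j, weight x i j = 0 →
        8 * (H / sqScale lam α T * (1 / (2 * κ) + lam * T)) ≤ 1 →
        |matW (θ T) i j| ≤
          sqScale lam α T * (32 * (H / sqScale lam α T * (1 / (2 * κ) + lam * T)) ^ 3) := by
  have hn' : (0 : ℝ) < n := by exact_mod_cast hn
  set κ : ℝ := 2 / n with hκdef
  have hκ : 0 < κ := by positivity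
  have hφ0 : 0 ≤ weightedError (weight x) X 0 :=
    Finset.sum_nonneg fun i _ => Finset.sum_nonneg fun j _ =>
      mul_nonneg (weight_nonneg x i j) (sq_nonneg _)
  -- `D²` dominates the initial error and `‖X‖² / (4κ)`; the `+ 1` gives the strictness needed by
  -- the barrier.
  set D : ℝ := Real.sqrt (weightedError (weight x) X 0 + ‖X‖ ^ 2 / (4 * κ) + 1) with hD
  have hDsq : D ^ 2 = weightedError (weight x) X 0 + ‖X‖ ^ 2 / (4 * κ) + 1 :=
    Real.sq_sqrt (by positivity)
  have hD0 : weightedError (weight x) X 0 ≤ D ^ 2 := by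
    have : 0 ≤ ‖X‖ ^ 2 / (4 * κ) := by positivity
    linarith
  have hDX : ‖X‖ ^ 2 < 4 * κ * D ^ 2 := by
    have : ‖X‖ ^ 2 / (4 * κ) < D ^ 2 := by linarith
    rw [div_lt_iff₀ (by positivity)] at this
    linarith
  have hDpos : 0 < D := Real.sqrt_pos.2 (by positivity)
  refine ⟨D, 2 * D, κ, by positivity, hκ, ?_⟩
  intro lam α T θ hlam hα hT hθ
  have hf := hθ.isRescaledFlow hX hα.ne'
  set m := sqScale lam α T with hmdef
  have hm : 0 < m := by rw [hmdef, sqScale]; positivity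
  have hμm : ∀ t ∈ Set.Icc 0 T, m ≤ sqScale lam α t := by
    intro t ht
    rw [hmdef, sqScale, sqScale]
    gcongr
    exact ht.2
  have hφ := weightedError_le (weight_nonneg x) (fun i j => mul_weight_le_sq x i j) hlam hm
    (hasDerivAt_sqScale lam α) hμm hf hD0 hDX
  refine ⟨?_, ?_⟩
  · have := hφ T ⟨hT, le_rfl⟩
    rwa [sqScale_smul_gramDiff hα.ne'] at this
  intro i j hij hsmall
  -- `g` comes from `‖S‖² ≤ 4 · weightedError` and `√(u² + v²) ≤ u + v`; `G` is its primitive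
  -- vanishing at `0`.
  set g : ℝ → ℝ := fun t => 2 * D * (Real.exp (-(2 * m * κ * t)) + lam / m) with hg
  set G : ℝ → ℝ := fun t => 2 * D * ((1 - Real.exp (-(2 * m * κ * t))) / (2 * m * κ) + lam / m * t)
    with hGdef
  have hgpos : ∀ t, 0 < g t := fun t => by simp only [hg]; positivity
  have hG : ∀ t, HasDerivAt G (g t) t := by
    intro t
    have h1 : HasDerivAt (fun t => Real.exp (-(2 * m * κ * t)))
        (Real.exp (-(2 * m * κ * t)) * (-(2 * m * κ))) t :=
      (((hasDerivAt_id t).const_mul (2 * m * κ)).neg.exp).congr_deriv (by simp)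
    refine ((((h1.const_sub 1).div_const (2 * m * κ)).add
      ((hasDerivAt_id t).const_mul (lam / m))).const_mul (2 * D)).congr_deriv ?_
    simp only [hg]
    field_simp
  have hG0 : G 0 = 0 := by simp [hGdef]
  have hGT : G T ≤ 2 * D / m * (1 / (2 * κ) + lam * T) := by
    have : (1 - Real.exp (-(2 * m * κ * T))) / (2 * m * κ) ≤ 1 / (2 * m * κ) := by
      gcongr
      linarith [Real.exp_pos (-(2 * m * κ * T))]
    calc G T ≤ 2 * D * (1 / (2 * m * κ) + lam / m * T) := by
          simp only [hGdef]
          gcongr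
      _ = _ := by field_simp
  have hGT0 : 0 ≤ G T := by
    rw [← hG0]
    exact (strictMono_of_hasDerivAt_pos hG hgpos).monotone hT
  have hS : ∀ t ∈ Set.Icc 0 T, ‖residual (weight x) X (sqScale lam α t •
      gramDiff (rescale lam α (fun t => matU (θ t)) t)
        (rescale lam α (fun t => matV (θ t)) t))‖ ≤ g t := by
    intro t ht
    refine le_of_sq_le_sq ?_ (hgpos t).le
    have h1 := hφ t ht
    have h2 := norm_residual_sq_le (a := weight x) (K := 4) (fun i j => by
      rw [pow_two]
      exact mul_le_mul_of_nonneg_right (weight_le_four hn x i j) (weight_nonneg x i j)) X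
      (sqScale lam α t • gramDiff (rescale lam α (fun t => matU (θ t)) t)
        (rescale lam α (fun t => matV (θ t)) t))
    refine h2.trans ((mul_le_mul_of_nonneg_left h1 (by norm_num)).trans ?_)
    have h3 : Real.exp (-(4 * m * κ * t)) = Real.exp (-(2 * m * κ * t)) ^ 2 := by
      rw [← Real.exp_nat_mul]
      congr 1
      push_cast
      ring
    have h4 : 0 ≤ D ^ 2 * (Real.exp (-(2 * m * κ * t)) * (lam / m)) := by positivity
    rw [h3, ← div_pow]
    simp only [hg]
    nlinarith
  have hmain := hf.abs_gramDiff_apply_le hG hgpos hG0 hS hT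
    ((mul_le_mul_of_nonneg_left hGT (by norm_num)).trans hsmall) (i := i) (j := j)
    (fun t => by rw [residual_apply, hij, zero_mul])
  rw [← sqScale_smul_gramDiff (lam := lam) hα.ne' θ T, Matrix.smul_apply, smul_eq_mul, abs_mul,
    abs_of_pos hm]
  refine mul_le_mul_of_nonneg_left (hmain.trans ?_) hm.le
  gcongr

end MatrixCompletion

end

/-! ### The limit at time `T`. -/

theorem mainTheorem7 {d n : ℕ} (hn : 0 < n)
    (Xstar : Matrix (Fin d) (Fin d) ℝ) (hX : Xstar.IsSymm)
    (x : Fin n → Fin d × Fin d)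
    (lam : ℝ → ℝ) (hlam_pos : ∀ α : ℝ, 0 < α → 0 < lam α)
    (p : ℝ) (hp : 0 < p) (hlam : lam =Θ[atTop] fun α : ℝ => α ^ (-p))
    (c : ℝ) (hc : c ∈ Set.Ioo (0 : ℝ) 1) :
    (∀ α : ℝ, 0 < α → ∃ θ : ℝ → MatrixCompletion.Param d,
      MatrixCompletion.IsGradientFlow Xstar x (lam α) (α • MatrixCompletion.initDir d) θ) ∧
    ∀ θ : ℝ → ℝ → MatrixCompletion.Param d,
      (∀ α : ℝ, 0 < α →
        MatrixCompletion.IsGradientFlow Xstar x (lam α) (α • MatrixCompletion.initDir d) (θ α)) →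
      ∀ i j : Fin d,
        Tendsto (fun α : ℝ => MatrixCompletion.matW (θ α ((1 - c) / lam α * Real.log α)) i j)
          atTop
          (𝓝 (if (i, j) ∈ MatrixCompletion.observed x ∨ (j, i) ∈ MatrixCompletion.observed x
            then Xstar i j else 0)) := by
  refine ⟨fun α hα => MatrixCompletion.exists_isGradientFlow Xstar x (hlam_pos α hα) _, ?_⟩
  intro θ hθ i j
  obtain ⟨D, H, κ, hH, hκ, hbound⟩ := MatrixCompletion.exists_error_bounds hn hX x
  have hc0 := hc.1
  have hc1 := hc.2
  have hlam0 : Tendsto lam atTop (𝓝 0) := hlam.1.trans_tendsto (tendsto_rpow_neg_atTop hp)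
  set T : ℝ → ℝ := fun α => (1 - c) / lam α * Real.log α with hT
  have hm : ∀ α : ℝ, 0 < α → MatrixCompletion.sqScale (lam α) α (T α) = α ^ (2 * c) := by
    intro α hα
    have h1 : 2 * lam α * T α = 2 * (1 - c) * Real.log α := by
      have := (hlam_pos α hα).ne'
      simp only [hT]
      field_simp
    rw [MatrixCompletion.sqScale, h1, Real.rpow_def_of_pos hα, ← Real.exp_log (pow_pos hα 2),
      ← Real.exp_add, Real.log_pow]
    congr 1
    push_cast
    ring
  have hlamT : ∀ α : ℝ, 0 < α → lam α * T α = (1 - c) * Real.log α := by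
    intro α hα
    have := (hlam_pos α hα).ne'
    simp only [hT]
    field_simp
  have hlaminv : Tendsto (fun α => (lam α)⁻¹) atTop atTop := by
    refine Tendsto.inv_tendsto_nhdsGT_zero (tendsto_nhdsWithin_iff.2 ⟨hlam0, ?_⟩)
    filter_upwards [eventually_gt_atTop 0] with α hα using hlam_pos α hα
  have hTtop : Tendsto T atTop atTop := by
    have := ((hlaminv.atTop_mul_atTop₀ Real.tendsto_log_atTop).const_mul_atTop
      (sub_pos.2 hc1))
    refine this.congr fun α => ?_
    simp only [hT]
    ring
  have hpow : Tendsto (fun α : ℝ => α ^ (2 * c)) atTop atTop :=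
    tendsto_rpow_atTop (by linarith)
  split_ifs with hij
  -- A single observed entry is controlled by the whole weighted error divided by its positive
  -- weight.
  · have hw := MatrixCompletion.weight_pos hn hij
    set w := MatrixCompletion.weight x i j with hwdef
    have hlim : Tendsto (fun α : ℝ => D ^ 2 * (Real.exp (-(4 * α ^ (2 * c) * κ * T α)) +
        lam α ^ 2 / (α ^ (2 * c)) ^ 2) / w) atTop (𝓝 0) := by
      have h1 : Tendsto (fun α : ℝ => Real.exp (-(4 * α ^ (2 * c) * κ * T α))) atTop (𝓝 0) := by
        refine Real.tendsto_exp_neg_atTop_nhds_zero.comp ?_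
        have := (hpow.atTop_mul_atTop₀ hTtop).const_mul_atTop (show 0 < 4 * κ by positivity)
        refine this.congr fun α => ?_
        ring
      have h2 : Tendsto (fun α : ℝ => lam α ^ 2 / (α ^ (2 * c)) ^ 2) atTop (𝓝 0) := by
        have := (hlam0.div_atTop hpow).pow 2
        simpa [div_pow] using this
      simpa using ((h1.add h2).const_mul (D ^ 2)).div_const w
    have hsq : Tendsto (fun α => (MatrixCompletion.matW (θ α (T α)) i j - Xstar i j) ^ 2)
        atTop (𝓝 0) := by
      refine squeeze_zero' (Eventually.of_forall fun _ => sq_nonneg _) ?_ hlim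
      filter_upwards [eventually_gt_atTop 0, hTtop.eventually_ge_atTop 0] with α hα hTα
      have h1 := (hbound (lam α) α (T α) (θ α) (hlam_pos α hα) hα hTα (hθ α hα)).1
      rw [hm α hα] at h1
      rw [le_div_iff₀ hw, mul_comm]
      refine le_trans ?_ h1
      have hnn : ∀ i j, 0 ≤ MatrixCompletion.weight x i j *
          (MatrixCompletion.matW (θ α (T α)) i j - Xstar i j) ^ 2 := fun i j =>
        mul_nonneg (MatrixCompletion.weight_nonneg x i j) (sq_nonneg _)
      exact (Finset.single_le_sum (fun j _ => hnn i j) (Finset.mem_univ j)).trans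
        (Finset.single_le_sum (f := fun i => ∑ j, MatrixCompletion.weight x i j *
          (MatrixCompletion.matW (θ α (T α)) i j - Xstar i j) ^ 2)
          (fun i _ => Finset.sum_nonneg fun j _ => hnn i j) (Finset.mem_univ i))
    have habs := hsq.sqrt
    simp only [Real.sqrt_sq_eq_abs, Real.sqrt_zero] at habs
    exact tendsto_sub_nhds_zero_iff.1 ((tendsto_zero_iff_abs_tendsto_zero _).2 habs)
  · have hw := MatrixCompletion.weight_eq_zero hij
    have hlog : ∀ r : ℝ, 0 < r → Tendsto
        (fun α : ℝ => (1 / (2 * κ) + (1 - c) * Real.log α) / α ^ r) atTop (𝓝 0) := by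
      intro r hr
      have h1 := (isLittleO_log_rpow_atTop hr).tendsto_div_nhds_zero.const_mul (1 - c)
      have h2 := (tendsto_const_nhds (x := 1 / (2 * κ))).div_atTop (tendsto_rpow_atTop hr)
      have h3 := h2.add h1
      simp only [mul_zero, add_zero] at h3
      refine h3.congr fun α => ?_
      ring
    have hsmall : Tendsto (fun α : ℝ => 8 * (H / α ^ (2 * c) *
        (1 / (2 * κ) + (1 - c) * Real.log α))) atTop (𝓝 0) := by
      have := (hlog (2 * c) (by linarith)).const_mul (8 * H)
      rw [mul_zero] at this
      refine this.congr fun α => ?_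
      ring
    have hlim : Tendsto (fun α : ℝ => α ^ (2 * c) * (32 * (H / α ^ (2 * c) *
        (1 / (2 * κ) + (1 - c) * Real.log α)) ^ 3)) atTop (𝓝 0) := by
      -- Distributing the prefactor over the cube: `α^{2c} (ℓ / α^{2c})³ = (ℓ / α^{4c/3})³`, where
      -- `ℓ` is the logarithmic factor.
      have := ((hlog (4 * c / 3) (by positivity)).pow 3).const_mul (32 * H ^ 3)
      simp only [ne_eq, OfNat.ofNat_ne_zero, not_false_eq_true, zero_pow, mul_zero] at this
      refine this.congr' ?_
      filter_upwards [eventually_gt_atTop 0] with α hα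
      have h1 : (α ^ (4 * c / 3)) ^ 3 = (α ^ (2 * c)) ^ 2 := by
        rw [← Real.rpow_natCast, ← Real.rpow_natCast, ← Real.rpow_mul hα.le, ← Real.rpow_mul hα.le]
        congr 1
        push_cast
        ring
      have h2 : 0 < α ^ (2 * c) := Real.rpow_pos_of_pos hα _
      rw [div_pow, h1]
      field_simp
    refine squeeze_zero_norm' ?_ hlim
    filter_upwards [eventually_gt_atTop 0, hTtop.eventually_ge_atTop 0,
      hsmall.eventually_le_const zero_lt_one] with α hα hTα hs
    have h1 := (hbound (lam α) α (T α) (θ α) (hlam_pos α hα) hα hTα (hθ α hα)).2 i j hw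
    rw [hm α hα, hlamT α hα] at h1
    exact h1 hs
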